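/- Let $d\in\mathbb N$, $a>0$, and let $t=\mathrm{ctr}(t)+[-a,a]^d$ and $s=\mathrm{ctr}(s)+[-a,a]^d$ be two cells of the same radius $a$ in $\mathbb R^d$. Let $G:\mathbb R^d\times\mathbb R^d\to\mathbb C$ be a kernel, and let $\tilde G(x,y):=G(\mathrm{ctr}(t)+x,\mathrm{ctr}(s)+y)$, regarded as a function of the $2d$ real variables $z=(x,y)$. Let $\mathcal A$ be a multipole acceptance criterion (a boolean function of pairs of cells, with value $1$ when the two cells are considered well-separated). Suppose that $\mathcal A(t,s)=1$, and that $\mathcal A(t,s)=1$ implies that $\tilde G$ is analytic in its variables at every point of $[-a,a]^{2d}$ with a convergence radius $R>\frac{2a}{e}$ in each variable, i.e. for every $p\in[-a,a]^{2d}$ there is a power series $\sum_{\beta\in\mathbb N^{2d}}c_\beta\,(z-p)^\beta$ that converges in the complex polydisc $\{z\in\mathbb C^{2d}: |z_i-p_i|<R,\ i=1,\dots,2d\}$ and whose sum is $\tilde G(z)$ for every $z\in[-a,a]^{2d}$ in this polydisc. For $L\ge 2$ let $\mathcal I_L^{t\times s}[\tilde G]$ be the tensor-product Lagrange interpolant of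 $\tilde G$ on $[-a,a]^{2d}$ with the $L$ equispaced nodes $x_k=-a+\frac{2ak}{L-1}$, $k=0,\dots,L-1$, in each variable. Then $$\lim_{L\to+\infty}\ \sup_{z\in[-a,a]^{2d}}\big|\mathcal I_L^{t\times s}[\tilde G](z)-\tilde G(z)\big|=0 .$$ Moreover, for every $r$ with $\frac{2a}{e}<r<R$ there is a constant $C>0$, independent of $L$, such that for all $L\ge 2$ $$\sup_{z\in[-a,a]^{2d}}\big|\mathcal I_L^{t\times s}[\tilde G](z)-\tilde G(z)\big|\ \le\ C\,r^{-2d}\,(2^{2d}-1)\Big(\frac{e}{\sqrt2}\Big)^{2d}\Big(\frac{2a}{re}\Big)^{L}.$$ -/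

import Mathlib

open Filter Topology

/-- A cell of the `2^d`-tree: the translate `ctr + [-a, a]^d` of a cube of radius `a > 0`. -/
structure Cell (d : ℕ) where
  ctr : Fin d → ℝ
  radius : ℝ
  radius_pos : 0 < radius

/-- The cube `[-a, a]^ι`. -/
def cube (ι : Type) (a : ℝ) : Set (ι → ℝ) :=
  {z | ∀ i, z i ∈ Set.Icc (-a) a}

/-- The kernel in coordinates relative to the two cell centers,
`G̃(x, y) = G(ctr t + x, ctr s + y)`, as a function of the `2d` variables `z = (x, y)`:
the `Sum.inl` variables are those of `x`, the `Sum.inr` variables those of `y`. -/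
def shiftedKernel {d : ℕ} (G : (Fin d → ℝ) → (Fin d → ℝ) → ℂ) (t s : Cell d) :
    (Fin d ⊕ Fin d → ℝ) → ℂ :=
  fun z => G (fun i => t.ctr i + z (Sum.inl i)) (fun i => s.ctr i + z (Sum.inr i))

/-- `f` is analytic in its variables at every point of the cube `[-a, a]^ι` with convergence
radius (at least) `R` in each variable: around every point `p` of the cube there is a power series
`∑ c_β (z - p)^β`, indexed by multi-indices `β`, which converges in the complex polydisc
`{z | |z_i - p_i| < R for all i}` and whose sum is `f` at the points of the cube in that
polydisc. -/
def AnalyticOnCubeWithRadius {ι : Type} [Fintype ι] (f : (ι → ℝ) → ℂ) (a R : ℝ) : Prop :=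
  ∀ p ∈ cube ι a, ∃ c : (ι → ℕ) → ℂ,
    (∀ w : ι → ℂ, (∀ i, ‖w i‖ < R) → Summable fun β : ι → ℕ => c β * ∏ i, w i ^ β i) ∧
    ∀ z ∈ cube ι a, (∀ i, |z i - p i| < R) →
      HasSum (fun β : ι → ℕ => c β * ∏ i, ((z i - p i : ℝ) : ℂ) ^ β i) (f z)

/-- The `k`-th of the `L` equispaced points of `[-a, a]`, `k = 0, …, L - 1` (for `L ≥ 2`). -/
noncomputable def equispacedNode (a : ℝ) (L : ℕ) (k : Fin L) : ℝ :=
  -a + 2 * a * (k : ℝ) / ((L : ℝ) - 1)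

/-- Tensor-product Lagrange interpolant of `f` on `[-a, a]^ι` with `L` equispaced points in each
variable: `∑_k f(x_k) ∏_i S_{k_i}(z_i)`, with `S_j` the one-dimensional Lagrange basis
polynomials. -/
noncomputable def tensorInterp {ι : Type} [Fintype ι] [DecidableEq ι] (a : ℝ) (L : ℕ)
    (f : (ι → ℝ) → ℂ) (z : ι → ℝ) : ℂ :=
  ∑ k : ι → Fin L, f (fun i => equispacedNode a L (k i)) *
    ((∏ i, (Lagrange.basis Finset.univ (equispacedNode a L) (k i)).eval (z i) : ℝ) : ℂ)

/-! In one variable the error of interpolation at `L` nodes is at most the nodal polynomial over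
`L!` times a bound for the `L`-th derivative. For equispaced nodes the nodal polynomial is at most
`L! (2a/(L-1))^L`, so the error is at most `(2a/(L-1))^L` times that bound
(`norm_sub_sum_equispaced_basis_le`).

The power series about the points of the compact cube give uniform Cauchy estimates: the mixed
derivative of order `γ` is at most `M ∏ γ_j!/r'^γ_j` for any `r' < R` (`exists_norm_mixedDeriv_le`).
By a weak Stirling bound, each variable differentiated `L` times then contributes at most `e² L
(2a/(r'e))^L`. Taking `r < r' < R` absorbs the factor `L` and leaves a multiple of `(2a/(re))^L`.

Equispaced interpolation operators are badly bounded, so the tensor product error is not telescoped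
through their norms. It is expanded instead into one-variable errors of derivatives: one term for
each nonempty set of variables differentiated `L` times, hence the factor `2^(2d) - 1`
(`norm_sub_interpList_le`). -/

/-! ### Lagrange interpolation error in one variable. -/

/-- Iterated Rolle theorem: if `φ 0, φ 1, …` are successive derivatives on `[a, b]` and `φ 0` has
`n + 1` zeros there, then `φ n` has a zero. -/
theorem exists_zero_of_strictMono_zeros {a b : ℝ} (n : ℕ) :
    ∀ φ : ℕ → ℝ → ℝ,
      (∀ m, ∀ x ∈ Set.Icc a b, HasDerivWithinAt (φ m) (φ (m + 1) x) (Set.Icc a b) x) →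
      ∀ z : Fin (n + 1) → ℝ, StrictMono z → (∀ k, z k ∈ Set.Icc a b) → (∀ k, φ 0 (z k) = 0) →
      ∃ ξ ∈ Set.Icc a b, φ n ξ = 0 := by
  induction n with
  | zero => exact fun φ _ z _ hz h0 => ⟨z 0, hz 0, h0 0⟩
  | succ n ih =>
    intro φ hφ z hmono hz h0
    have key : ∀ k : Fin (n + 1), ∃ ξ ∈ Set.Ioo (z k.castSucc) (z k.succ), φ 1 ξ = 0 := by
      intro k
      have hsub : Set.Icc (z k.castSucc) (z k.succ) ⊆ Set.Icc a b :=
        Set.Icc_subset_Icc (hz _).1 (hz _).2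
      refine exists_hasDerivAt_eq_zero (f := φ 0) (hmono k.castSucc_lt_succ)
        (fun x hx => ((hφ 0 x (hsub hx)).mono hsub).continuousWithinAt) (by rw [h0, h0]) ?_
      intro x hx
      have hx' : Set.Icc a b ∈ 𝓝 x :=
        mem_of_superset (Icc_mem_nhds hx.1 hx.2) hsub
      exact (hφ 0 x (hsub (Set.Ioo_subset_Icc_self hx))).hasDerivAt hx'
    choose ξ hξ hξ0 using key
    refine ih (fun m => φ (m + 1)) (fun m => hφ (m + 1)) ξ ?_ ?_ hξ0
    · intro k l hkl
      have : z k.succ ≤ z l.castSucc := hmono.monotone (by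
        rw [Fin.le_def]; simpa using hkl)
      exact ((hξ k).2.trans_le this).trans (hξ l).1
    · exact fun k => ⟨(hz _).1.trans (hξ k).1.le, (hξ k).2.le.trans (hz _).2⟩

open Polynomial in
/-- Error bound for real Lagrange interpolation at distinct nodes. -/
theorem abs_sub_eval_interpolate_le {a b : ℝ} {L : ℕ} {v : Fin L → ℝ} (hv : Function.Injective v)
    (hvI : ∀ k, v k ∈ Set.Icc a b) (h : ℕ → ℝ → ℝ)
    (hd : ∀ m, ∀ x ∈ Set.Icc a b, HasDerivWithinAt (h m) (h (m + 1) x) (Set.Icc a b) x)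
    {B : ℝ} (hB : ∀ x ∈ Set.Icc a b, |h L x| ≤ B) {x : ℝ} (hx : x ∈ Set.Icc a b) :
    |h 0 x - (Lagrange.interpolate Finset.univ v (fun k => h 0 (v k))).eval x| ≤
      |∏ k, (x - v k)| / L.factorial * B := by
  have hL : (0 : ℝ) < L.factorial := by exact_mod_cast L.factorial_pos
  by_cases hxv : ∃ k, x = v k
  · obtain ⟨k, rfl⟩ := hxv
    rw [Lagrange.eval_interpolate_at_node _ hv.injOn (Finset.mem_univ k), sub_self, abs_zero]
    have := (abs_nonneg _).trans (hB _ hx)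
    positivity
  push Not at hxv
  set p := Lagrange.interpolate Finset.univ v (fun k => h 0 (v k)) with hp
  set w := Lagrange.nodal (Finset.univ : Finset (Fin L)) v with hw
  have hwx : w.eval x = ∏ k, (x - v k) := Lagrange.eval_nodal
  have hwx0 : w.eval x ≠ 0 := by
    rw [hwx]; exact Finset.prod_ne_zero_iff.2 fun k _ => sub_ne_zero.2 (hxv k)
  -- This `c` makes `h 0 - p - c w` vanish at `x` as well as at the `L` nodes; its `L`-th derivative
  -- is `h L - c L!`.
  set c := (h 0 x - p.eval x) / w.eval x with hc
  set P := p + C c * w with hP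
  have hPd : (derivative^[L]) P = C (c * L.factorial) := by
    have h1 : (derivative^[L]) p = 0 := by
      rcases eq_or_ne p 0 with h0 | h0
      · rw [h0]; simp
      · apply iterate_derivative_eq_zero
        rw [natDegree_lt_iff_degree_lt h0]
        have := Lagrange.degree_interpolate_lt (s := Finset.univ) (fun k => h 0 (v k)) hv.injOn
        rwa [← hp, Finset.card_univ, Fintype.card_fin] at this
    have h2 : (derivative^[L]) w = C (L.factorial : ℝ) := by
      have hdeg : w.natDegree = L := by rw [hw, Lagrange.natDegree_nodal]; simp
      have := natDegree_iterate_derivative w L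
      rw [hdeg, Nat.sub_self] at this
      rw [eq_C_of_natDegree_le_zero this, coeff_iterate_derivative, zero_add,
        Nat.descFactorial_self]
      have hm : w.coeff L = 1 := by
        have := (Lagrange.nodal_monic (s := (Finset.univ : Finset (Fin L))) (v := v)).coeff_natDegree
        rwa [← hw, hdeg] at this
      rw [hm]; simp
    rw [hP, iterate_map_add, h1, iterate_derivative_C_mul, h2, zero_add, C_mul]
  let s : Finset ℝ := insert x (Finset.univ.image v)
  have hs : s.card = L + 1 := by
    rw [Finset.card_insert_of_notMem, Finset.card_image_of_injective _ hv]
    · simp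
    · simpa using fun k => (hxv k).symm
  have hroot : ∀ y ∈ s, h 0 y - P.eval y = 0 := by
    intro y hy
    rcases Finset.mem_insert.1 hy with rfl | hy
    · rw [hP, eval_add, eval_mul, eval_C, hc, div_mul_cancel₀ _ hwx0]; ring
    · obtain ⟨k, -, rfl⟩ := Finset.mem_image.1 hy
      rw [hP, eval_add, eval_mul, hw, Lagrange.eval_nodal_at_node (Finset.mem_univ k), hp,
        Lagrange.eval_interpolate_at_node _ hv.injOn (Finset.mem_univ k)]
      ring
  have hsI : ∀ y ∈ s, y ∈ Set.Icc a b := by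
    intro y hy
    rcases Finset.mem_insert.1 hy with rfl | hy
    · exact hx
    · obtain ⟨k, -, rfl⟩ := Finset.mem_image.1 hy
      exact hvI k
  obtain ⟨ξ, hξ, hξ0⟩ := exists_zero_of_strictMono_zeros L
    (fun m y => h m y - ((derivative^[m]) P).eval y)
    (fun m y hy => by
      rw [Function.iterate_succ_apply']
      exact (hd m y hy).sub (((derivative^[m]) P).hasDerivWithinAt y _))
    (s.orderEmbOfFin hs) (s.orderEmbOfFin hs).strictMono
    (fun k => hsI _ (s.orderEmbOfFin_mem hs k)) (fun k => hroot _ (s.orderEmbOfFin_mem hs k))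
  rw [hPd, eval_C, sub_eq_zero] at hξ0
  have hcB := hB ξ hξ
  rw [hξ0, abs_mul, abs_of_pos hL, ← le_div_iff₀ hL] at hcB
  have : h 0 x - p.eval x = c * w.eval x := by rw [hc, div_mul_cancel₀ _ hwx0]
  rw [this, abs_mul, hwx, mul_comm]
  calc _ ≤ |∏ k, (x - v k)| * (B / L.factorial) := by gcongr
    _ = _ := by ring

/-- Error bound for Lagrange interpolation of a complex-valued function at distinct nodes. -/
theorem norm_sub_sum_basis_le {a b : ℝ} {L : ℕ} {v : Fin L → ℝ} (hv : Function.Injective v)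
    (hvI : ∀ k, v k ∈ Set.Icc a b) (h : ℕ → ℝ → ℂ)
    (hd : ∀ m, ∀ x ∈ Set.Icc a b, HasDerivWithinAt (h m) (h (m + 1) x) (Set.Icc a b) x)
    {B : ℝ} (hB : ∀ x ∈ Set.Icc a b, ‖h L x‖ ≤ B) {x : ℝ} (hx : x ∈ Set.Icc a b) :
    ‖h 0 x - ∑ k, h 0 (v k) * (((Lagrange.basis Finset.univ v k).eval x : ℝ) : ℂ)‖ ≤
      |∏ k, (x - v k)| / L.factorial * B := by
  set E := h 0 x - ∑ k, h 0 (v k) * (((Lagrange.basis Finset.univ v k).eval x : ℝ) : ℂ) with hE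
  -- Rotating the error onto the positive real axis reduces to the real function `Re (u h)`, since
  -- the basis polynomials are real.
  obtain ⟨u, hu, huE⟩ : ∃ u : ℂ, ‖u‖ = 1 ∧ u * E = ‖E‖ := by
    rcases eq_or_ne E 0 with h0 | h0
    · exact ⟨1, by simp, by simp [h0]⟩
    · refine ⟨‖E‖ / E, ?_, by rw [div_mul_cancel₀ _ h0]⟩
      rw [norm_div, Complex.norm_real, norm_norm, div_self (norm_ne_zero_iff.2 h0)]
  have key := abs_sub_eval_interpolate_le hv hvI (fun m y => (u * h m y).re)
    (fun m y hy => by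
      have := (Complex.reCLM.hasFDerivAt.comp_hasDerivWithinAt y ((hd m y hy).const_mul u))
      exact this)
    (B := B) (fun y hy => (Complex.abs_re_le_norm _).trans (by
      rw [norm_mul, hu, one_mul]; exact hB y hy)) hx
  have : (u * h 0 x).re - (Lagrange.interpolate Finset.univ v
      (fun k => (u * h 0 (v k)).re)).eval x = ‖E‖ := by
    rw [← Complex.ofReal_re ‖E‖, ← huE, hE, mul_sub, Complex.sub_re, Lagrange.interpolate_apply,
      Polynomial.eval_finsetSum, Finset.mul_sum, Complex.re_sum]
    congr 1
    refine Finset.sum_congr rfl fun k _ => ?_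
    rw [Polynomial.eval_mul, Polynomial.eval_C, ← mul_assoc, Complex.re_mul_ofReal]
  rw [this, abs_of_nonneg (norm_nonneg _)] at key
  exact key

/-! ### Power series on the cube: termwise derivatives and Cauchy estimates. -/

/-- `c p` are the coefficients of a power series of `f` about `p`, for every point `p` of the cube
`[-a, a]^ι`, that converges absolutely in the polydisc of radius `R` and has sum `f` at the points
of the cube in that polydisc. -/
structure HasCubeExpansion {ι : Type} [Fintype ι] (a R : ℝ) (f : (ι → ℝ) → ℂ)
    (c : (ι → ℝ) → (ι → ℕ) → ℂ) : Prop where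
  summable : ∀ p ∈ cube ι a, ∀ ρ, 0 ≤ ρ → ρ < R → Summable fun β => ‖c p β‖ * ∏ j, ρ ^ β j
  hasSum : ∀ p ∈ cube ι a, ∀ z ∈ cube ι a, (∀ i, |z i - p i| < R) →
    HasSum (fun β : ι → ℕ => c p β * ∏ j, ((z j - p j : ℝ) : ℂ) ^ β j) (f z)

/-- Coefficients of the `γ`-th partial derivative of the power series with coefficients `c`. -/
def derivCoeff {ι : Type} [Fintype ι] (γ : ι → ℕ) (c : (ι → ℕ) → ℂ) (β : ι → ℕ) : ℂ :=
  (∏ j, ((β j + 1).ascFactorial (γ j) : ℂ)) * c (β + γ)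

/-- The left side is a single term of the binomial expansion of the right side. -/
theorem choose_mul_pow_mul_pow_le {x y : ℝ} (hx : 0 ≤ x) (hy : 0 ≤ y) (m n : ℕ) :
    ((m + n).choose n : ℝ) * (x ^ m * y ^ n) ≤ (x + y) ^ (m + n) := by
  rw [add_pow]
  have := Finset.single_le_sum (s := Finset.range (m + n + 1))
    (f := fun k => x ^ k * y ^ (m + n - k) * ((m + n).choose k : ℝ))
    (fun k _ => by positivity) (Finset.mem_range.2 (by omega : m < m + n + 1))
  refine le_trans (le_of_eq ?_) this
  simp only [Nat.add_sub_cancel_left]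
  rw [Nat.choose_symm_add]; ring

/-- Each rising factorial is `γ_j!` times a binomial coefficient. Enlarging the radius from `x` to
`x + y` pays for the differentiation, which is the source of the Cauchy estimates. -/
theorem prod_ascFactorial_mul_le {ι : Type} [Fintype ι] {x y : ℝ} (hx : 0 ≤ x)
    (hy : 0 < y) (β γ : ι → ℕ) :
    (∏ j, ((β j + 1).ascFactorial (γ j) : ℝ)) * ∏ j, x ^ β j ≤
      (∏ j, ((γ j).factorial : ℝ) / y ^ γ j) * ∏ j, (x + y) ^ (β + γ) j := by
  rw [← Finset.prod_mul_distrib, ← Finset.prod_mul_distrib]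
  refine Finset.prod_le_prod (fun j _ => by positivity) fun j _ => ?_
  have h := choose_mul_pow_mul_pow_le hx hy.le (β j) (γ j)
  rw [Nat.ascFactorial_eq_factorial_mul_choose, Pi.add_apply]
  push_cast
  rw [div_mul_eq_mul_div, le_div_iff₀ (by positivity)]
  calc _ = ((γ j).factorial : ℝ) * (((β j + γ j).choose (γ j) : ℝ) * (x ^ β j * y ^ γ j)) := by ring
    _ ≤ _ := by gcongr

/-- A term of the differentiated series on the polydisc of radius `x`, bounded by the corresponding
term of the original series on the polydisc of radius `x + y`. -/
theorem norm_derivCoeff_mul_le {ι : Type} [Fintype ι] {x y : ℝ} (hx : 0 ≤ x)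
    (hy : 0 < y) (c : (ι → ℕ) → ℂ)
    (β γ : ι → ℕ) :
    ‖derivCoeff γ c β‖ * ∏ j, x ^ β j ≤
      (∏ j, ((γ j).factorial : ℝ) / y ^ γ j) * (‖c (β + γ)‖ * ∏ j, (x + y) ^ (β + γ) j) := by
  have := prod_ascFactorial_mul_le hx hy β γ
  rw [derivCoeff, norm_mul, norm_prod]
  simp only [RCLike.norm_natCast]
  calc _ = ‖c (β + γ)‖ * ((∏ j, ((β j + 1).ascFactorial (γ j) : ℝ)) * ∏ j, x ^ β j) := by ring
    _ ≤ ‖c (β + γ)‖ * ((∏ j, ((γ j).factorial : ℝ) / y ^ γ j) * ∏ j, (x + y) ^ (β + γ) j) := by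
      gcongr
    _ = _ := by ring

theorem derivCoeff_zero {ι : Type} [Fintype ι] (c : (ι → ℕ) → ℂ) : derivCoeff 0 c = c := by
  funext β; simp [derivCoeff]

theorem derivCoeff_single {ι : Type} [Fintype ι] [DecidableEq ι] (i : ι) (c : (ι → ℕ) → ℂ)
    (β : ι → ℕ) :
    derivCoeff (Pi.single i 1) c β = (β i + 1) * c (β + Pi.single i 1) := by
  rw [derivCoeff, Finset.prod_eq_single i]
  · simp [Nat.ascFactorial]
  · intro j _ hj; simp [Pi.single_eq_of_ne hj]
  · simp

theorem derivCoeff_single_derivCoeff {ι : Type} [Fintype ι] [DecidableEq ι] (i : ι) (γ : ι → ℕ)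
    (c : (ι → ℕ) → ℂ) :
    derivCoeff (Pi.single i 1) (derivCoeff γ c) = derivCoeff (γ + Pi.single i 1) c := by
  funext β
  rw [derivCoeff_single, derivCoeff, derivCoeff, ← mul_assoc]
  have : β + Pi.single i 1 + γ = β + (γ + Pi.single i 1) := by abel
  rw [this]
  congr 1
  rw [← Finset.mul_prod_erase _ _ (Finset.mem_univ i),
    ← Finset.mul_prod_erase _ _ (Finset.mem_univ i),
    ← mul_assoc]
  congr 1
  · simp only [Pi.add_apply, Pi.single_eq_same]
    have h := Nat.succ_ascFactorial (β i + 1) (γ i)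
    rw [Nat.ascFactorial_succ, ← h]
    push_cast; ring
  · refine Finset.prod_congr rfl fun j hj => ?_
    simp [Pi.single_eq_of_ne (Finset.ne_of_mem_erase hj)]

theorem update_mem_cube {ι : Type} [DecidableEq ι] {a : ℝ} {z : ι → ℝ} (hz : z ∈ cube ι a)
    {i : ι} {t : ℝ} (ht : t ∈ Set.Icc (-a) a) : Function.update z i t ∈ cube ι a := by
  intro j
  rcases eq_or_ne j i with rfl | hj
  · simpa using ht
  · simpa [Function.update_of_ne hj] using hz j

/-- Termwise differentiation in the `i`-th variable of a multivariate power series. -/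
theorem hasDerivAt_tsum_update {ι : Type} [Fintype ι] [DecidableEq ι] {c : (ι → ℕ) → ℂ} {R : ℝ}
    (i : ι)
    (hc : ∀ ρ, 0 ≤ ρ → ρ < R → Summable fun β => ‖c β‖ * ∏ j, ρ ^ β j)
    {w : ι → ℝ} (hw : ∀ j, |w j| < R) (s : ℝ) :
    HasDerivAt (fun t => ∑' β : ι → ℕ, c β * ∏ j, ((Function.update w i (t - s) j : ℝ) : ℂ) ^ β j)
      (∑' β : ι → ℕ, derivCoeff (Pi.single i 1) c β * ∏ j, ((w j : ℝ) : ℂ) ^ β j) (w i + s) := by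
  have hR : 0 < R := (abs_nonneg _).trans_lt (hw i)
  obtain ⟨ρ, hρ0, hρ, hwρ⟩ : ∃ ρ, 0 < ρ ∧ ρ < R ∧ ∀ j, |w j| < ρ := by
    have h1 : ‖w‖ < R := (pi_norm_lt_iff hR).2 hw
    obtain ⟨ρ, h2, h3⟩ := exists_between h1
    exact ⟨ρ, (norm_nonneg w).trans_lt h2, h3, fun j => (norm_le_pi_norm w j).trans_lt h2⟩
  obtain ⟨ρ', hρ', hρR⟩ := exists_between hρ
  let T : (ι → ℕ) → ℂ := fun β => c β * ∏ j ∈ Finset.univ.erase i, ((w j : ℝ) : ℂ) ^ β j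
  have hsplit : ∀ (β : ι → ℕ) (t : ℝ), c β * ∏ j, ((Function.update w i (t - s) j : ℝ) : ℂ) ^ β j =
      T β * ((t - s : ℝ) : ℂ) ^ β i := by
    intro β t
    rw [← Finset.mul_prod_erase _ _ (Finset.mem_univ i)]
    have : ∏ j ∈ Finset.univ.erase i, ((Function.update w i (t - s) j : ℝ) : ℂ) ^ β j =
        ∏ j ∈ Finset.univ.erase i, ((w j : ℝ) : ℂ) ^ β j :=
      Finset.prod_congr rfl fun j hj => by
        rw [Function.update_of_ne (Finset.ne_of_mem_erase hj)]
    rw [this, Function.update_self]; ring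
  simp only [hsplit]
  have hinj : Function.Injective fun β : ι → ℕ => β + Pi.single i 1 := add_left_injective _
  let g' : (ι → ℕ) → ℝ → ℂ := fun β t => T β * ((β i : ℂ) * ((t - s : ℝ) : ℂ) ^ (β i - 1))
  -- Terms with `β i = 0` are constant in `t`, so the differentiated series lives on shifted
  -- multi-indices and can be reindexed by the shift.
  have hg'0 : ∀ t, ∀ β ∉ Set.range fun β : ι → ℕ => β + Pi.single i 1, g' β t = 0 := by
    intro t β hβ
    have : β i = 0 := by
      by_contra h0
      refine hβ ⟨β - Pi.single i 1, ?_⟩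
      funext j
      rcases eq_or_ne j i with rfl | hj
      · simp; omega
      · simp [Pi.single_eq_of_ne hj]
    simp [g', this]
  have hg'1 : ∀ t β, g' (β + Pi.single i 1) t = derivCoeff (Pi.single i 1) c β *
      ∏ j, ((Function.update w i (t - s) j : ℝ) : ℂ) ^ β j := by
    intro t β
    rw [derivCoeff_single, ← Finset.mul_prod_erase _ _ (Finset.mem_univ i)]
    have : ∏ j ∈ Finset.univ.erase i, ((Function.update w i (t - s) j : ℝ) : ℂ) ^ β j =
        ∏ j ∈ Finset.univ.erase i, ((w j : ℝ) : ℂ) ^ (β + Pi.single i 1 : ι → ℕ) j :=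
      Finset.prod_congr rfl fun j hj => by
        rw [Function.update_of_ne (Finset.ne_of_mem_erase hj)]
        simp [Pi.single_eq_of_ne (Finset.ne_of_mem_erase hj)]
    rw [this, Function.update_self]
    simp only [g', T, Pi.add_apply, Pi.single_eq_same, Nat.add_sub_cancel]
    push_cast
    ring
  set y := ρ' - ρ with hy
  have hy0 : 0 < y := sub_pos.2 hρ'
  let K : ℝ := ∏ j, (((Pi.single i 1 : ι → ℕ) j).factorial : ℝ) / y ^ (Pi.single i 1 : ι → ℕ) j
  have hK : 0 ≤ K := Finset.prod_nonneg fun j _ => by positivity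
  have hu : Summable fun β => K * (‖c β‖ * ∏ j, ρ' ^ β j) :=
    (hc ρ' (hρ0.trans hρ').le hρR).mul_left K
  have hball : ∀ t : ℝ, t ∈ Metric.ball s ρ → |t - s| < ρ := fun t ht => ht
  have hbound : ∀ (β : ι → ℕ) (t : ℝ), t ∈ Metric.ball s ρ →
      ‖g' β t‖ ≤ K * (‖c β‖ * ∏ j, ρ' ^ β j) := by
    intro β t ht
    by_cases hβ : β ∈ Set.range fun β : ι → ℕ => β + Pi.single i 1
    · obtain ⟨α, rfl⟩ := hβ
      dsimp only
      rw [hg'1, norm_mul, norm_prod]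
      have h2 := norm_derivCoeff_mul_le hρ0.le hy0 c α (Pi.single i 1)
      rw [hy, add_sub_cancel] at h2
      refine le_trans ?_ h2
      refine mul_le_mul_of_nonneg_left (Finset.prod_le_prod (fun j _ => norm_nonneg _) ?_)
        (norm_nonneg _)
      intro j _
      rw [norm_pow, Complex.norm_real]
      refine pow_le_pow_left₀ (norm_nonneg _) ?_ _
      rcases eq_or_ne j i with rfl | hj
      · rw [Function.update_self]; exact (hball t ht).le
      · rw [Function.update_of_ne hj]; exact (hwρ j).le
    · rw [hg'0 t β hβ, norm_zero]
      have : 0 ≤ ∏ j, ρ' ^ β j := Finset.prod_nonneg fun j _ => pow_nonneg (hρ0.trans hρ').le _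
      positivity
  have hmem : w i + s ∈ Metric.ball s ρ := by
    rw [Metric.mem_ball, Real.dist_eq, add_sub_cancel_right]; exact hwρ i
  have hsum0 : Summable fun β => T β * ((w i + s - s : ℝ) : ℂ) ^ β i := by
    simp_rw [← hsplit, add_sub_cancel_right, Function.update_eq_self]
    refine Summable.of_norm_bounded (hc ρ hρ0.le hρ) fun β => ?_
    rw [norm_mul, norm_prod]
    refine mul_le_mul_of_nonneg_left (Finset.prod_le_prod (fun j _ => norm_nonneg _) ?_)
      (norm_nonneg _)
    intro j _
    rw [norm_pow, Complex.norm_real]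
    exact pow_le_pow_left₀ (norm_nonneg _) (hwρ j).le _
  have key := hasDerivAt_tsum_of_isPreconnected (𝕜 := ℝ) (F := ℂ)
    (g := fun β t => T β * ((t - s : ℝ) : ℂ) ^ β i) (g' := g') hu Metric.isOpen_ball
    (convex_ball s ρ).isPreconnected
    (fun β t _ => by
      have h1 : HasDerivAt (fun t : ℝ => ((t - s : ℝ) : ℂ)) 1 t := by
        simpa using ((hasDerivAt_id t).sub_const s).ofReal_comp
      simpa [g'] using (h1.pow (β i)).const_mul (T β))
    hbound hmem hsum0 hmem
  rw [← hinj.tsum_eq (Function.support_subset_iff'.2 (hg'0 (w i + s)))] at key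
  simpa only [hg'1, add_sub_cancel_right, Function.update_eq_self] using key

namespace HasCubeExpansion

variable {ι : Type} [Fintype ι] {a R : ℝ} {f : (ι → ℝ) → ℂ} {c : (ι → ℝ) → (ι → ℕ) → ℂ}

/-- At its own centre a series reduces to its constant term. Thus `f` is the case `γ = 0` of the
family `z ↦ derivCoeff γ (c z) 0` of mixed derivatives. -/
theorem eq_coeff_zero (h : HasCubeExpansion a R f c) (hR : 0 < R) {z : ι → ℝ}
    (hz : z ∈ cube ι a) : f z = c z 0 := by
  refine (h.hasSum z hz z hz (fun _ => by simpa using hR)).unique ?_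
  have := hasSum_single (f := fun β : ι → ℕ => c z β * ∏ j, ((z j - z j : ℝ) : ℂ) ^ β j) 0 ?_
  · simpa using this
  · intro β hβ
    obtain ⟨j, hj⟩ := Function.ne_iff.1 hβ
    rw [Finset.prod_eq_zero (Finset.mem_univ j) (by simpa using hj), mul_zero]

theorem summable_derivCoeff (h : HasCubeExpansion a R f c) (γ : ι → ℕ) {p : ι → ℝ}
    (hp : p ∈ cube ι a) {ρ : ℝ} (hρ0 : 0 ≤ ρ) (hρ : ρ < R) :
    Summable fun β => ‖derivCoeff γ (c p) β‖ * ∏ j, ρ ^ β j := by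
  obtain ⟨ρ', hρ', hρR⟩ := exists_between hρ
  have h1 := ((h.summable p hp ρ' (hρ0.trans hρ'.le) hρR).comp_injective
    (add_left_injective γ)).mul_left (∏ j, ((γ j).factorial : ℝ) / (ρ' - ρ) ^ γ j)
  refine Summable.of_nonneg_of_le
    (fun β => mul_nonneg (norm_nonneg _) (Finset.prod_nonneg fun j _ => by positivity))
    (fun β => ?_) h1
  have := norm_derivCoeff_mul_le hρ0 (sub_pos.2 hρ') (c p) β γ
  rwa [add_sub_cancel] at this

variable [DecidableEq ι]

theorem hasDerivWithinAt_tsum (h : HasCubeExpansion a R f c) {p z : ι → ℝ} (hp : p ∈ cube ι a)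
    (hz : z ∈ cube ι a) (hpz : ∀ j, |z j - p j| < R) (i : ι) :
    HasDerivWithinAt (fun t => f (Function.update z i t))
      (∑' β : ι → ℕ, derivCoeff (Pi.single i 1) (c p) β * ∏ j, ((z j - p j : ℝ) : ℂ) ^ β j)
      (Set.Icc (-a) a) (z i) := by
  have h1 := hasDerivAt_tsum_update i (h.summable p hp) (w := fun j => z j - p j) hpz (p i)
  rw [sub_add_cancel] at h1
  have hU : Metric.ball (p i) R ∈ 𝓝 (z i) := Metric.isOpen_ball.mem_nhds (hpz i)
  refine h1.hasDerivWithinAt.congr_of_eventuallyEq_of_mem ?_ (hz i)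
  filter_upwards [mem_nhdsWithin_of_mem_nhds hU, self_mem_nhdsWithin] with t ht htI
  have hupd : ∀ j, Function.update z i t j - p j =
      Function.update (fun j => z j - p j) i (t - p i) j := by
    intro j
    rcases eq_or_ne j i with rfl | hj
    · simp
    · simp [Function.update_of_ne hj]
  have h2 := h.hasSum p hp _ (update_mem_cube hz htI (i := i)) (fun j => by
    rcases eq_or_ne j i with rfl | hj
    · rw [Function.update_self]; exact ht
    · rw [Function.update_of_ne hj]; exact hpz j)
  simp only [hupd] at h2
  exact h2.tsum_eq.symm

/-- The partial derivative in the `i`-th variable exists on the cube and has the termwise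
differentiated expansions. -/
theorem partialDeriv (h : HasCubeExpansion a R f c) (ha : 0 < a) (hR : 0 < R) (i : ι) :
    HasCubeExpansion a R (fun z => derivCoeff (Pi.single i 1) (c z) 0)
      (fun z => derivCoeff (Pi.single i 1) (c z)) ∧
    ∀ z ∈ cube ι a, HasDerivWithinAt (fun t => f (Function.update z i t))
      (derivCoeff (Pi.single i 1) (c z) 0) (Set.Icc (-a) a) (z i) := by
  have hder : ∀ z ∈ cube ι a, HasDerivWithinAt (fun t => f (Function.update z i t))
      (derivCoeff (Pi.single i 1) (c z) 0) (Set.Icc (-a) a) (z i) := by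
    intro z hz
    convert h.hasDerivWithinAt_tsum hz hz (fun _ => by simpa using hR) i using 1
    rw [tsum_eq_single 0]
    · simp
    · intro β hβ
      obtain ⟨j, hj⟩ := Function.ne_iff.1 hβ
      rw [Finset.prod_eq_zero (Finset.mem_univ j) (by simpa using hj), mul_zero]
  refine ⟨⟨fun p hp ρ => h.summable_derivCoeff _ hp, fun p hp z hz hpz => ?_⟩, hder⟩
  -- The series about `z` and about `p` both differentiate `f` at `z`, possibly one-sidedly;
  -- uniqueness of the derivative identifies the two values.
  have hu : UniqueDiffWithinAt ℝ (Set.Icc (-a) a) (z i) :=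
    uniqueDiffOn_Icc (by linarith) _ (hz i)
  rw [hu.eq_deriv _ (hder z hz) (h.hasDerivWithinAt_tsum hp hz hpz i)]
  refine Summable.hasSum ?_
  have h1 : ‖fun j => z j - p j‖ < R := (pi_norm_lt_iff hR).2 hpz
  refine Summable.of_norm_bounded
    (h.summable_derivCoeff (Pi.single i 1) hp (norm_nonneg _) h1) fun β => ?_
  rw [norm_mul, norm_prod]
  refine mul_le_mul_of_nonneg_left (Finset.prod_le_prod (fun j _ => norm_nonneg _) ?_)
    (norm_nonneg _)
  intro j _
  rw [norm_pow, Complex.norm_real]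
  exact pow_le_pow_left₀ (norm_nonneg _) (norm_le_pi_norm (fun j => z j - p j) j) _

/-- The mixed partial derivative of order `γ` has the termwise differentiated expansions. -/
theorem mixedDeriv (h : HasCubeExpansion a R f c) (ha : 0 < a) (hR : 0 < R) (γ : ι → ℕ) :
    HasCubeExpansion a R (fun z => derivCoeff γ (c z) 0) (fun z => derivCoeff γ (c z)) := by
  induction hn : ∑ j, γ j generalizing γ with
  | zero =>
    have : γ = 0 := funext fun j => by simpa using Finset.sum_eq_zero_iff.1 hn j (Finset.mem_univ j)
    subst this
    simp only [derivCoeff_zero]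
    refine ⟨h.summable, fun p hp z hz hpz => ?_⟩
    rw [← h.eq_coeff_zero hR hz]
    exact h.hasSum p hp z hz hpz
  | succ n ih =>
    obtain ⟨i, hi⟩ : ∃ i, γ i ≠ 0 := by
      by_contra! h0
      simp [h0] at hn
    have hγ : γ - Pi.single i 1 + Pi.single i 1 = γ := by
      funext j
      rcases eq_or_ne j i with rfl | hj
      · simp; omega
      · simp [Pi.single_eq_of_ne hj]
    have hs : ∑ j, (γ - Pi.single i 1 : ι → ℕ) j = n := by
      have := congrArg (fun γ => ∑ j, γ j) hγ
      simp only [Pi.add_apply, Finset.sum_add_distrib, Finset.sum_pi_single', hn] at this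
      simpa using this
    have := ((ih _ hs).partialDeriv ha hR i).1
    simpa only [derivCoeff_single_derivCoeff, hγ] using this

theorem hasDerivWithinAt_mixedDeriv (h : HasCubeExpansion a R f c) (ha : 0 < a) (hR : 0 < R)
    (γ : ι → ℕ) (i : ι) {z : ι → ℝ} (hz : z ∈ cube ι a) :
    HasDerivWithinAt (fun t => derivCoeff γ (c (Function.update z i t)) 0)
      (derivCoeff (γ + Pi.single i 1) (c z) 0) (Set.Icc (-a) a) (z i) := by
  have := ((h.mixedDeriv ha hR γ).partialDeriv ha hR i).2 z hz
  simpa only [derivCoeff_single_derivCoeff] using this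

/-- Uniform Cauchy estimates for all mixed partial derivatives on the cube. -/
theorem exists_norm_mixedDeriv_le (h : HasCubeExpansion a R f c) (ha : 0 < a) {r : ℝ}
    (hr : 0 < r) (hrR : r < R) :
    ∃ M, 0 ≤ M ∧ ∀ z ∈ cube ι a, ∀ γ : ι → ℕ,
      ‖derivCoeff γ (c z) 0‖ ≤ M * ∏ j, ((γ j).factorial : ℝ) / r ^ γ j := by
  obtain ⟨r', hr', hrR'⟩ := exists_between hrR
  have hδ : 0 < r' - r := sub_pos.2 hr'
  have hcpt : IsCompact (cube ι a) := by
    have : cube ι a = Set.pi Set.univ fun _ => Set.Icc (-a) a := by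
      ext z; simp only [cube, Set.mem_ofPred_eq, Set.mem_univ_pi]
    rw [this]
    exact isCompact_univ_pi fun _ => isCompact_Icc
  have key := hcpt.induction_on (p := fun s => ∃ M, 0 ≤ M ∧ ∀ z ∈ s, z ∈ cube ι a → ∀ γ : ι → ℕ,
      ‖derivCoeff γ (c z) 0‖ ≤ M * ∏ j, ((γ j).factorial : ℝ) / r ^ γ j)
    ⟨0, le_rfl, by simp⟩
    (fun s t hst ⟨M, hM, H⟩ => ⟨M, hM, fun z hz => H z (hst hz)⟩)
    (fun s t ⟨M, hM, H⟩ ⟨M', hM', H'⟩ => ⟨max M M', hM.trans (le_max_left _ _), ?_⟩) ?_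
  · obtain ⟨M, hM, H⟩ := key
    exact ⟨M, hM, fun z hz => H z hz hz⟩
  · intro z hz hzc γ
    have h0 : 0 ≤ ∏ j, ((γ j).factorial : ℝ) / r ^ γ j :=
      Finset.prod_nonneg fun j _ => by positivity
    rcases hz with hz | hz
    · exact (H z hz hzc γ).trans (mul_le_mul_of_nonneg_right (le_max_left _ _) h0)
    · exact (H' z hz hzc γ).trans (mul_le_mul_of_nonneg_right (le_max_right _ _) h0)
  · intro p hp
    have hsum := h.summable p hp r' (hr.trans hr').le hrR'
    have hnn : ∀ β, 0 ≤ ‖c p β‖ * ∏ j, r' ^ β j := fun β =>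
      mul_nonneg (norm_nonneg _) (Finset.prod_nonneg fun j _ => pow_nonneg (hr.trans hr').le _)
    -- The radius `r'` is split: `r' - r` for moving the point away from `p`, and `r` for the Cauchy
    -- estimate. The local constant is the absolute sum of the series about `p` on radius `r'`.
    refine ⟨Metric.ball p (r' - r), mem_nhdsWithin_of_mem_nhds (Metric.ball_mem_nhds _ hδ),
      ∑' β, ‖c p β‖ * ∏ j, r' ^ β j, tsum_nonneg hnn, fun z hz hzc γ => ?_⟩
    have hzp : ∀ j, |z j - p j| < r' - r := (dist_pi_lt_iff hδ).1 hz
    have h1 := (h.mixedDeriv ha (hr.trans hrR) γ).hasSum p hp z hzc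
      fun j => (hzp j).trans (by linarith)
    have hcomp := hsum.comp_injective (add_left_injective γ)
    have h2 := hcomp.mul_left (∏ j, ((γ j).factorial : ℝ) / r ^ γ j)
    have h3 : ∀ β, ‖derivCoeff γ (c p) β * ∏ j, ((z j - p j : ℝ) : ℂ) ^ β j‖ ≤
        (∏ j, ((γ j).factorial : ℝ) / r ^ γ j) * (‖c p (β + γ)‖ * ∏ j, r' ^ (β + γ) j) := by
      intro β
      have := norm_derivCoeff_mul_le hδ.le hr (c p) β γ
      rw [sub_add_cancel] at this
      refine le_trans ?_ this
      rw [norm_mul, norm_prod]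
      refine mul_le_mul_of_nonneg_left (Finset.prod_le_prod (fun j _ => norm_nonneg _) ?_)
        (norm_nonneg _)
      intro j _
      rw [norm_pow, Complex.norm_real]
      exact pow_le_pow_left₀ (norm_nonneg _) (hzp j).le _
    rw [← h1.tsum_eq, mul_comm]
    refine (tsum_of_norm_bounded h2.hasSum h3).trans ?_
    rw [tsum_mul_left]
    refine mul_le_mul_of_nonneg_left ?_ (Finset.prod_nonneg fun j _ => by positivity)
    exact tsum_comp_le_tsum_of_inj hsum hnn (add_left_injective γ)

end HasCubeExpansion

/-! ### Equispaced nodes. -/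

theorem equispacedNode_injective {a : ℝ} (ha : 0 < a) {L : ℕ} (hL : 2 ≤ L) :
    Function.Injective (equispacedNode a L) := by
  intro k l hkl
  have hL1 : (0 : ℝ) < (L : ℝ) - 1 := by
    have : (2 : ℝ) ≤ L := by exact_mod_cast hL
    linarith
  simp only [equispacedNode, add_right_inj] at hkl
  rw [div_left_inj' hL1.ne', mul_right_inj' (by positivity)] at hkl
  exact Fin.ext (by exact_mod_cast hkl)

theorem equispacedNode_mem_Icc {a : ℝ} (ha : 0 < a) {L : ℕ} (hL : 2 ≤ L) (k : Fin L) :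
    equispacedNode a L k ∈ Set.Icc (-a) a := by
  have hL1 : (0 : ℝ) < (L : ℝ) - 1 := by
    have : (2 : ℝ) ≤ L := by exact_mod_cast hL
    linarith
  have hk : (k : ℝ) ≤ (L : ℝ) - 1 := by
    have : (k : ℝ) + 1 ≤ L := by exact_mod_cast k.2
    linarith
  have h1 : 0 ≤ 2 * a * (k : ℝ) / ((L : ℝ) - 1) := by positivity
  have h2 : 2 * a * (k : ℝ) / ((L : ℝ) - 1) ≤ 2 * a := by
    rw [div_le_iff₀ hL1]; gcongr
  constructor <;> simp only [equispacedNode] <;> linarith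

/-- The nodal polynomial of equispaced nodes on `[-a, a]`. -/
theorem abs_prod_sub_equispacedNode_le {a : ℝ} (ha : 0 < a) {L : ℕ} (hL : 2 ≤ L) {x : ℝ}
    (hx : x ∈ Set.Icc (-a) a) :
    |∏ k, (x - equispacedNode a L k)| ≤ L.factorial * (2 * a / ((L : ℝ) - 1)) ^ L := by
  have hL1 : (0 : ℝ) < (L : ℝ) - 1 := by
    have : (2 : ℝ) ≤ L := by exact_mod_cast hL
    linarith
  set h := 2 * a / ((L : ℝ) - 1) with hh
  have hpos : 0 < h := by positivity
  have hLh : ((L : ℝ) - 1) * h = 2 * a := by rw [hh]; field_simp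
  obtain ⟨m, rfl⟩ : ∃ m, L = m + 1 := ⟨L - 1, by omega⟩
  have hm : ((m + 1 : ℕ) : ℝ) - 1 = m := by push_cast; ring
  rw [hm] at hLh
  set y := (x + a) / h with hy
  have hy0 : 0 ≤ y := div_nonneg (by linarith [hx.1]) hpos.le
  have hym : y ≤ m := by
    rw [hy, div_le_iff₀ hpos, hLh]; linarith [hx.2]
  have hxy : ∀ k : Fin (m + 1), x - equispacedNode a (m + 1) k = h * (y - k) := by
    intro k
    have h1 : equispacedNode a (m + 1) k = -a + h * k := by
      rw [equispacedNode, hh]; ring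
    have h2 : h * y = x + a := by rw [hy]; field_simp
    rw [h1, mul_sub, h2]; ring
  -- In mesh units, the nodes up to `j` lie within `1, …, j + 1` of `y` and the remaining `l` nodes
  -- within `1, …, l`. The product is thus at most `(j + 1)! l!`, which divides into `(m + 1)!`.
  set j := ⌊y⌋₊ with hj
  have hj1 : (j : ℝ) ≤ y := Nat.floor_le hy0
  have hj2 : y < j + 1 := Nat.lt_floor_add_one y
  have hjm : j ≤ m := by exact_mod_cast hj1.trans hym
  have hfac : ∏ k ∈ Finset.range (m + 1), |y - k| ≤ ((m + 1).factorial : ℝ) := by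
    obtain ⟨l, hl⟩ : ∃ l, m + 1 = j + 1 + l := ⟨m - j, by omega⟩
    rw [hl, Finset.prod_range_add]
    have h1 : ∏ k ∈ Finset.range (j + 1), |y - k| ≤ ((j + 1).factorial : ℝ) := by
      rw [← Finset.prod_range_add_one_eq_factorial, ← Finset.prod_range_reflect]
      push_cast
      refine Finset.prod_le_prod (fun k _ => abs_nonneg _) fun k hk => ?_
      have hk' : k ≤ j := by simpa [Nat.lt_succ_iff] using hk
      rw [Nat.cast_sub hk']
      have : (k : ℝ) ≤ j := by exact_mod_cast hk'
      rw [abs_le]; constructor <;> linarith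
    have h2 : ∏ k ∈ Finset.range l, |y - ((j + 1 + k : ℕ) : ℝ)| ≤ (l.factorial : ℝ) := by
      rw [← Finset.prod_range_add_one_eq_factorial]
      push_cast
      refine Finset.prod_le_prod (fun k _ => abs_nonneg _) fun k _ => ?_
      have : (0 : ℝ) ≤ k := Nat.cast_nonneg k
      rw [abs_le]; constructor <;> linarith
    have h3 : ((j + 1).factorial * l.factorial : ℝ) ≤ ((j + 1 + l).factorial : ℝ) := by
      exact_mod_cast Nat.le_of_dvd (Nat.factorial_pos _)
        (Nat.factorial_mul_factorial_dvd_factorial_add _ _)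
    exact (mul_le_mul h1 h2 (Finset.prod_nonneg fun _ _ => abs_nonneg _) (by positivity)).trans h3
  simp only [hxy]
  rw [Finset.abs_prod]
  simp only [abs_mul, abs_of_pos hpos]
  rw [Finset.prod_mul_distrib, Finset.prod_const, Finset.card_univ, Fintype.card_fin,
    Fin.prod_univ_eq_prod_range (fun k => |y - (k : ℝ)|) (m + 1), mul_comm]
  gcongr

/-- One-dimensional error bound for interpolation at equispaced nodes. -/
theorem norm_sub_sum_equispaced_basis_le {a : ℝ} (ha : 0 < a) {L : ℕ} (hL : 2 ≤ L)
    (h : ℕ → ℝ → ℂ)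
    (hd : ∀ m, ∀ x ∈ Set.Icc (-a) a, HasDerivWithinAt (h m) (h (m + 1) x) (Set.Icc (-a) a) x)
    {B : ℝ} (hB : ∀ x ∈ Set.Icc (-a) a, ‖h L x‖ ≤ B) {x : ℝ} (hx : x ∈ Set.Icc (-a) a) :
    ‖h 0 x - ∑ k, h 0 (equispacedNode a L k) *
        (((Lagrange.basis Finset.univ (equispacedNode a L) k).eval x : ℝ) : ℂ)‖ ≤
      (2 * a / ((L : ℝ) - 1)) ^ L * B := by
  refine (norm_sub_sum_basis_le (equispacedNode_injective ha hL) (equispacedNode_mem_Icc ha hL)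
    h hd hB hx).trans ?_
  have hB0 : 0 ≤ B := (norm_nonneg _).trans (hB x hx)
  refine mul_le_mul_of_nonneg_right ?_ hB0
  rw [div_le_iff₀ (by positivity), mul_comm]
  exact abs_prod_sub_equispacedNode_le ha hL hx

/-! ### Tensor-product interpolation, one variable at a time. -/

section Multivariate

variable {ι : Type} [DecidableEq ι]

/-- Lagrange interpolation at the `L` equispaced nodes in the `i`-th variable. -/
noncomputable def interpAt (a : ℝ) (L : ℕ) (i : ι) (f : (ι → ℝ) → ℂ) (z : ι → ℝ) : ℂ :=
  ∑ k, f (Function.update z i (equispacedNode a L k)) *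
    (((Lagrange.basis Finset.univ (equispacedNode a L) k).eval (z i) : ℝ) : ℂ)

/-- Successive interpolation in the variables of a list. -/
noncomputable def interpList (a : ℝ) (L : ℕ) : List ι → ((ι → ℝ) → ℂ) → (ι → ℝ) → ℂ
  | [], f => f
  | i :: l, f => interpAt a L i (interpList a L l f)

theorem interpAt_sub (a : ℝ) (L : ℕ) (i : ι) (f g : (ι → ℝ) → ℂ) (z : ι → ℝ) :
    interpAt a L i (fun z => f z - g z) z = interpAt a L i f z - interpAt a L i g z := by
  simp only [interpAt, sub_mul, Finset.sum_sub_distrib]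

/-- The second function is the partial derivative of the first one in the `i`-th variable on the cube. -/
def HasPartialDerivOn (a : ℝ) (i : ι) (F F' : (ι → ℝ) → ℂ) : Prop :=
  ∀ z ∈ cube ι a, HasDerivWithinAt (fun t => F (Function.update z i t)) (F' z)
    (Set.Icc (-a) a) (z i)

theorem HasPartialDerivOn.sub {a : ℝ} {i : ι} {F F' G G' : (ι → ℝ) → ℂ}
    (hF : HasPartialDerivOn a i F F') (hG : HasPartialDerivOn a i G G') :
    HasPartialDerivOn a i (fun z => F z - G z) (fun z => F' z - G' z) :=
  fun z hz => (hF z hz).sub (hG z hz)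

/-- Interpolation in variable `j` is a finite combination of values with coefficients independent of
`z i`, so it commutes with differentiation in variable `i`. -/
theorem HasPartialDerivOn.interpAt {a : ℝ} (ha : 0 < a) {L : ℕ} (hL : 2 ≤ L) {i j : ι}
    (hij : i ≠ j) {F F' : (ι → ℝ) → ℂ} (hF : HasPartialDerivOn a i F F') :
    HasPartialDerivOn a i (interpAt a L j F) (interpAt a L j F') := by
  intro z hz
  refine HasDerivWithinAt.fun_sum fun k _ => ?_
  have h1 := hF _ (update_mem_cube hz (equispacedNode_mem_Icc ha hL k) (i := j))
  rw [Function.update_of_ne hij] at h1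
  simp only [Function.update_of_ne hij.symm]
  simp only [Function.update_comm hij.symm] at h1
  exact h1.mul_const _

theorem HasPartialDerivOn.interpList {a : ℝ} (ha : 0 < a) {L : ℕ} (hL : 2 ≤ L) {i : ι}
    {l : List ι} (hil : i ∉ l) {F F' : (ι → ℝ) → ℂ} (hF : HasPartialDerivOn a i F F') :
    HasPartialDerivOn a i (interpList a L l F) (interpList a L l F') := by
  induction l with
  | nil => exact hF
  | cons j l ih =>
    rw [List.mem_cons, not_or] at hil
    exact (ih hil.2).interpAt ha hL hil.1

theorem norm_sub_interpAt_le {a : ℝ} (ha : 0 < a) {L : ℕ} (hL : 2 ≤ L) {i : ι}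
    {F : ℕ → (ι → ℝ) → ℂ} (hF : ∀ n, HasPartialDerivOn a i (F n) (F (n + 1))) {B : ℝ}
    (hB : ∀ z ∈ cube ι a, ‖F L z‖ ≤ B) {z : ι → ℝ} (hz : z ∈ cube ι a) :
    ‖F 0 z - interpAt a L i (F 0) z‖ ≤ (2 * a / ((L : ℝ) - 1)) ^ L * B := by
  have := norm_sub_sum_equispaced_basis_le ha hL (fun n t => F n (Function.update z i t))
    (fun n t ht => by simpa using hF n _ (update_mem_cube hz ht (i := i)))
    (fun t ht => hB _ (update_mem_cube hz ht)) (hz i)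
  simpa only [Function.update_eq_self, interpAt] using this

/-- Tensor-product interpolation error in terms of mixed derivatives, each of order `0` or `L` in
every variable. -/
theorem norm_sub_interpList_le {a : ℝ} (ha : 0 < a) {L : ℕ} (hL : 2 ≤ L)
    {F : (ι → ℕ) → (ι → ℝ) → ℂ}
    (hF : ∀ γ i, HasPartialDerivOn a i (F γ) (F (γ + Pi.single i 1))) {l : List ι}
    (hl : l.Nodup) :
    ∀ (γ : ι → ℕ) (N : ℝ),
      (∀ S ⊆ l.toFinset, S.Nonempty → ∀ z ∈ cube ι a,
        ((2 * a / ((L : ℝ) - 1)) ^ L) ^ S.card *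
          ‖F (γ + fun i => if i ∈ S then L else 0) z‖ ≤ N) →
      ∀ z ∈ cube ι a, ‖F γ z - interpList a L l (F γ) z‖ ≤ (2 ^ l.length - 1) * N := by
  set K := (2 * a / ((L : ℝ) - 1)) ^ L with hK
  have hK0 : 0 < K := by
    have : (2 : ℝ) ≤ L := by exact_mod_cast hL
    have : (0 : ℝ) < (L : ℝ) - 1 := by linarith
    positivity
  induction l with
  | nil => intro γ N _ z _; simp [interpList]
  | cons i l ih =>
    intro γ N hN z hz
    obtain ⟨hil, hl'⟩ := List.nodup_cons.1 hl
    let e : (ι → ℕ) → (ι → ℝ) → ℂ := fun γ z => F γ z - interpList a L l (F γ) z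
    have hsingle : ∀ n : ℕ, Pi.single i (n + 1) = (Pi.single i n + Pi.single i 1 : ι → ℕ) :=
      fun n => by rw [← Pi.single_add]
    have hFi : ∀ n : ℕ, HasPartialDerivOn a i (F (γ + Pi.single i n))
        (F (γ + Pi.single i (n + 1))) := by
      intro n
      rw [hsingle, ← add_assoc]
      exact hF _ i
    have hei : ∀ n : ℕ, HasPartialDerivOn a i (e (γ + Pi.single i n))
        (e (γ + Pi.single i (n + 1))) :=
      fun n => (hFi n).sub ((hFi n).interpList ha hL hil)
    have hind : ∀ S : Finset ι, i ∉ S → (γ + Pi.single i L + fun j => if j ∈ S then L else 0) =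
        γ + fun j => if j ∈ insert i S then L else 0 := by
      intro S hS
      funext j
      rcases eq_or_ne j i with rfl | hj
      · simp [hS]
      · simp [hj]
    have h1 : ‖e γ z‖ ≤ (2 ^ l.length - 1) * N := by
      refine ih hl' γ N (fun S hS hne => hN S (hS.trans ?_) hne) z hz
      simp
    have h2 : ‖F γ z - interpAt a L i (F γ) z‖ ≤ N := by
      have hB : ∀ z ∈ cube ι a, ‖F (γ + Pi.single i L) z‖ ≤ N / K := by
        intro z hz
        have := hN {i} (by simp) (by simp) z hz
        have hi := hind ∅ (by simp)
        simp only [Finset.notMem_empty, if_false, insert_empty_eq] at hi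
        rw [← hi, Finset.card_singleton, pow_one] at this
        rw [le_div_iff₀' hK0]
        exact this
      have := norm_sub_interpAt_le ha hL hFi hB hz
      rw [← hK, mul_div_cancel₀ _ hK0.ne'] at this
      simpa using this
    have h3 : ‖e γ z - interpAt a L i (e γ) z‖ ≤ (2 ^ l.length - 1) * N := by
      -- The `L`-th derivative of `e` in variable `i` is again an interpolation error, so induction
      -- applies to it. Passing from `S` to `insert i S` costs one factor `K`, hence `N / K`.
      have hB : ∀ z ∈ cube ι a, ‖e (γ + Pi.single i L) z‖ ≤ (2 ^ l.length - 1) * (N / K) := by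
        refine ih hl' (γ + Pi.single i L) (N / K) fun S hS hne z hz => ?_
        have hiS : i ∉ S := fun h => hil (by simpa using hS h)
        have := hN (insert i S) (by
          rw [List.toFinset_cons]; exact Finset.insert_subset_insert i hS) (by simp) z hz
        rw [Finset.card_insert_of_notMem hiS, pow_succ, ← hind S hiS] at this
        rw [le_div_iff₀' hK0]
        linarith
      have := norm_sub_interpAt_le ha hL hei hB hz
      rw [← hK] at this
      simp only [Pi.single_zero, add_zero] at this
      refine this.trans (le_of_eq ?_)
      field_simp
    -- Every term is an interpolation error, so no operator norm of `interpAt` enters. The count is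
    -- `(2^n - 1) + 1 + (2^n - 1) = 2^(n+1) - 1`, with `n` the length of `l`.
    have hdecomp : F γ z - interpList a L (i :: l) (F γ) z =
        e γ z + (F γ z - interpAt a L i (F γ) z) - (e γ z - interpAt a L i (e γ) z) := by
      have : interpAt a L i (e γ) z =
          interpAt a L i (F γ) z - interpAt a L i (interpList a L l (F γ)) z :=
        interpAt_sub a L i _ _ z
      rw [this]
      simp only [interpList, e]; ring
    rw [hdecomp, List.length_cons, pow_succ]
    calc _ ≤ ‖e γ z‖ + ‖F γ z - interpAt a L i (F γ) z‖ + ‖e γ z - interpAt a L i (e γ) z‖ :=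
          (norm_sub_le _ _).trans (add_le_add_left (norm_add_le _ _) _)
      _ ≤ _ := by linarith

/-- Successive interpolation as a sum over grid points; the variables outside the list carry a
partition of unity. -/
theorem interpList_eq_sum [Fintype ι] {a : ℝ} (ha : 0 < a) {L : ℕ} (hL : 2 ≤ L)
    (f : (ι → ℝ) → ℂ) {l : List ι} (hl : l.Nodup) (z : ι → ℝ) :
    interpList a L l f z = ∑ k : ι → Fin L,
      f (l.toFinset.piecewise (fun i => equispacedNode a L (k i)) z) *
        ((∏ i, (Lagrange.basis Finset.univ (equispacedNode a L) (k i)).eval (z i) : ℝ) : ℂ) := by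
  have hinj := equispacedNode_injective ha hL
  induction l generalizing z with
  | nil =>
    have hpt : ∀ k : ι → Fin L,
        ([] : List ι).toFinset.piecewise (fun i => equispacedNode a L (k i)) z = z :=
      fun k => funext fun j => by simp [Finset.piecewise]
    simp only [interpList, hpt]
    rw [← Finset.mul_sum, ← Complex.ofReal_sum,
      ← Fintype.prod_sum (fun i k => (Lagrange.basis Finset.univ (equispacedNode a L) k).eval (z i))]
    have : ∀ i, ∑ k, (Lagrange.basis Finset.univ (equispacedNode a L) k).eval (z i) = 1 := by
      intro i
      have : Nonempty (Fin L) := ⟨⟨0, by omega⟩⟩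
      rw [← Polynomial.eval_finsetSum, Lagrange.sum_basis hinj.injOn Finset.univ_nonempty,
        Polynomial.eval_one]
    simp [this]
  | cons i l ih =>
    obtain ⟨hil, hl'⟩ := List.nodup_cons.1 hl
    simp only [interpList, interpAt, ih hl', Finset.sum_mul]
    rw [Finset.sum_comm]
    refine Finset.sum_congr rfl fun k _ => ?_
    -- The `i`-th basis polynomial is evaluated at a node, where it is 0 or 1, so only the summand
    -- whose node index is `k i` survives.
    rw [Finset.sum_eq_single (k i)]
    · have hpt : l.toFinset.piecewise (fun i => equispacedNode a L (k i))
          (Function.update z i (equispacedNode a L (k i))) =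
          (i :: l).toFinset.piecewise (fun i => equispacedNode a L (k i)) z := by
        funext j
        rcases eq_or_ne j i with rfl | hj
        · simp [Finset.piecewise, hil]
        · simp [Finset.piecewise, hj]
      rw [hpt, mul_assoc, ← Complex.ofReal_mul]
      congr 2
      rw [← Finset.mul_prod_erase _ _ (Finset.mem_univ i),
        ← Finset.mul_prod_erase _ _ (Finset.mem_univ i), Function.update_self,
        Lagrange.eval_basis_self hinj.injOn (Finset.mem_univ _), one_mul, mul_comm]
      congr 1
      refine Finset.prod_congr rfl fun j hj => ?_
      rw [Function.update_of_ne (Finset.ne_of_mem_erase hj)]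
    · intro m _ hm
      rw [Finset.prod_eq_zero (Finset.mem_univ i)]
      · simp
      · rw [Function.update_self, Lagrange.eval_basis_of_ne hm.symm (Finset.mem_univ _)]
    · simp

theorem tensorInterp_eq_interpList [Fintype ι] {a : ℝ} (ha : 0 < a) {L : ℕ} (hL : 2 ≤ L)
    (f : (ι → ℝ) → ℂ) (z : ι → ℝ) :
    tensorInterp a L f z = interpList a L Finset.univ.toList f z := by
  rw [interpList_eq_sum ha hL f (Finset.nodup_toList _), Finset.toList_toFinset]
  simp only [Finset.piecewise_univ, tensorInterp]

end Multivariate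

/-! ### Stirling-type bounds and geometric convergence. -/

/-- A weak Stirling bound. The induction step is `(1 - 1/(m+1))^(m+1) ≤ e⁻¹`. -/
theorem factorial_mul_exp_le {m : ℕ} (hm : 1 ≤ m) :
    (m.factorial : ℝ) * Real.exp 1 ^ m ≤ Real.exp 1 * (m : ℝ) ^ (m + 1) := by
  induction m, hm using Nat.le_induction with
  | base => simp
  | succ m hm ih =>
    have hm0 : (0 : ℝ) < m := by exact_mod_cast hm
    have h1 : (m : ℝ) / (m + 1) ≤ Real.exp (-(1 / (m + 1))) := by
      refine le_trans (le_of_eq ?_) (Real.add_one_le_exp _)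
      field_simp; ring
    have h2 : Real.exp 1 * (m : ℝ) ^ (m + 1) ≤ ((m : ℝ) + 1) ^ (m + 1) := by
      have h3 : ((m : ℝ) / (m + 1)) ^ (m + 1) ≤ Real.exp (-1) := by
        refine (pow_le_pow_left₀ (by positivity) h1 _).trans (le_of_eq ?_)
        rw [← Real.exp_nat_mul]
        congr 1
        push_cast
        field_simp
      rw [div_pow, div_le_iff₀ (by positivity), Real.exp_neg, inv_mul_eq_div,
        le_div_iff₀' (Real.exp_pos 1)] at h3
      exact h3
    rw [Nat.factorial_succ]
    push_cast
    calc _ = ((m : ℝ) + 1) * Real.exp 1 * (m.factorial * Real.exp 1 ^ m) := by ring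
      _ ≤ ((m : ℝ) + 1) * Real.exp 1 * (Real.exp 1 * (m : ℝ) ^ (m + 1)) := by gcongr
      _ ≤ ((m : ℝ) + 1) * Real.exp 1 * ((m : ℝ) + 1) ^ (m + 1) := by gcongr
      _ = _ := by ring

/-- With `m = L - 1`, the denominator `m^(m+1)` is exactly the power in the Stirling bound; the `L`
on the right comes from `L! = L m!`. -/
theorem nodal_factor_le {a r : ℝ} (ha : 0 < a) (hr : 0 < r) {L : ℕ} (hL : 2 ≤ L) :
    (2 * a / ((L : ℝ) - 1)) ^ L * (L.factorial / r ^ L) ≤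
      Real.exp 1 ^ 2 * (L * (2 * a / (r * Real.exp 1)) ^ L) := by
  obtain ⟨m, rfl⟩ : ∃ m, L = m + 1 := ⟨L - 1, by omega⟩
  have hm : 1 ≤ m := by omega
  have hm0 : (0 : ℝ) < m := by exact_mod_cast hm
  have h := factorial_mul_exp_le hm
  have hcast : ((m + 1 : ℕ) : ℝ) - 1 = m := by push_cast; ring
  rw [hcast]
  have he := Real.exp_pos 1
  have heq : (2 * a / (m : ℝ)) ^ (m + 1) * ((m + 1).factorial / r ^ (m + 1)) =
      ((m + 1 : ℕ) * (2 * a / (r * Real.exp 1)) ^ (m + 1)) * Real.exp 1 *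
        ((m.factorial * Real.exp 1 ^ m) / (m : ℝ) ^ (m + 1)) := by
    rw [Nat.factorial_succ]
    push_cast
    simp only [div_pow, mul_pow, pow_succ]
    field_simp
  rw [heq]
  have h2 : (m.factorial * Real.exp 1 ^ m) / (m : ℝ) ^ (m + 1) ≤ Real.exp 1 := by
    rwa [div_le_iff₀ (by positivity)]
  calc _ ≤ ((m + 1 : ℕ) * (2 * a / (r * Real.exp 1)) ^ (m + 1)) * Real.exp 1 * Real.exp 1 := by
        gcongr
    _ = _ := by ring

/-- Bernoulli's inequality for `(q/p)^n`. -/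
theorem exists_nat_mul_pow_le {p q : ℝ} (hp : 0 < p) (hpq : p < q) :
    ∃ C, 0 < C ∧ ∀ n : ℕ, (n : ℝ) * p ^ n ≤ C * q ^ n := by
  have h1 : 0 < q / p - 1 := sub_pos.2 ((one_lt_div hp).2 hpq)
  refine ⟨(q / p - 1)⁻¹, inv_pos.2 h1, fun n => ?_⟩
  have h2 := one_add_mul_le_pow (by linarith : -2 ≤ q / p - 1) n
  rw [add_sub_cancel, div_pow, le_div_iff₀ (by positivity)] at h2
  rw [inv_mul_eq_div, le_div_iff₀ h1]
  have : 0 < p ^ n := by positivity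
  linarith

/-- Summability in `ℂ` is absolute, so evaluating at `(ρ, …, ρ)` gives the majorant series. -/
theorem AnalyticOnCubeWithRadius.exists_hasCubeExpansion {ι : Type} [Fintype ι]
    {f : (ι → ℝ) → ℂ} {a R : ℝ} (h : AnalyticOnCubeWithRadius f a R) :
    ∃ c, HasCubeExpansion a R f c := by
  classical
  choose! c hc hf using h
  refine ⟨c, fun p hp ρ hρ0 hρ => ?_, hf⟩
  have := (hc p hp (fun _ => (ρ : ℂ)) (fun _ => by
    rwa [Complex.norm_real, Real.norm_of_nonneg hρ0])).norm
  simpa [norm_prod, abs_of_nonneg hρ0] using this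

/-- Geometric convergence of tensor-product interpolation at equispaced nodes on a cube. -/
theorem AnalyticOnCubeWithRadius.exists_norm_tensorInterp_sub_le {ι : Type} [Fintype ι]
    [DecidableEq ι] {f : (ι → ℝ) → ℂ} {a R : ℝ} (h : AnalyticOnCubeWithRadius f a R)
    (ha : 0 < a) {r : ℝ} (hr : 2 * a / Real.exp 1 < r) (hrR : r < R) :
    ∃ C, 0 < C ∧ ∀ L : ℕ, 2 ≤ L → ∀ z ∈ cube ι a,
      ‖tensorInterp a L f z - f z‖ ≤
        (2 ^ Fintype.card ι - 1) * (C * (2 * a / (r * Real.exp 1)) ^ L) := by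
  have he := Real.exp_pos 1
  have hr0 : 0 < r := lt_trans (by positivity) hr
  obtain ⟨r', hr', hrR'⟩ := exists_between hrR
  have hr0' : 0 < r' := hr0.trans hr'
  obtain ⟨c, hc⟩ := h.exists_hasCubeExpansion
  have hR : 0 < R := hr0.trans hrR
  obtain ⟨M, hM, hMb⟩ := hc.exists_norm_mixedDeriv_le ha hr0' hrR'
  set q := 2 * a / (r * Real.exp 1) with hq
  have hq0 : 0 < q := by positivity
  have hq1 : q ≤ 1 := by
    rw [hq, div_le_one (by positivity)]
    rw [div_lt_iff₀ he] at hr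
    exact hr.le
  obtain ⟨A, hA, hAb⟩ := exists_nat_mul_pow_le (p := 2 * a / (r' * Real.exp 1)) (q := q)
    (by positivity) (by rw [hq]; gcongr)
  -- `D ≥ 1` lets `D ^ S.card` be bounded uniformly in `S`; `M + 1` below keeps the constant
  -- positive.
  set D := max 1 (Real.exp 1 ^ 2 * A) with hD
  have hD1 : 1 ≤ D := le_max_left _ _
  refine ⟨(M + 1) * D ^ Fintype.card ι, by positivity, fun L hL z hz => ?_⟩
  have hθ : (2 * a / ((L : ℝ) - 1)) ^ L * (L.factorial / r' ^ L) ≤ D * q ^ L :=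
    calc _ ≤ Real.exp 1 ^ 2 * (L * (2 * a / (r' * Real.exp 1)) ^ L) := nodal_factor_le ha hr0' hL
      _ ≤ Real.exp 1 ^ 2 * (A * q ^ L) := mul_le_mul_of_nonneg_left (hAb L) (by positivity)
      _ = Real.exp 1 ^ 2 * A * q ^ L := by ring
      _ ≤ D * q ^ L := by gcongr; exact le_max_right _ _
  have hL1 : (0 : ℝ) < (L : ℝ) - 1 := by
    have : (2 : ℝ) ≤ L := by exact_mod_cast hL
    linarith
  have key := norm_sub_interpList_le ha hL (F := fun γ z => derivCoeff γ (c z) 0)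
    (fun γ i z hz => hc.hasDerivWithinAt_mixedDeriv ha hR γ i hz)
    (Finset.nodup_toList Finset.univ) 0 ((M + 1) * D ^ Fintype.card ι * q ^ L) ?_ z hz
  · simp only [derivCoeff_zero, Finset.length_toList, Finset.card_univ] at key
    have hinterp : tensorInterp a L f z = tensorInterp a L (fun z => c z 0) z :=
      Finset.sum_congr rfl fun k _ => by
        rw [hc.eq_coeff_zero hR fun i => equispacedNode_mem_Icc ha hL (k i)]
    rw [norm_sub_rev, hinterp, tensorInterp_eq_interpList ha hL, hc.eq_coeff_zero hR hz]
    exact key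
  · intro S _ hS z hz
    rw [zero_add]
    have hprod : ∏ j, (((if j ∈ S then L else 0 : ℕ).factorial : ℝ) /
        r' ^ (if j ∈ S then L else 0 : ℕ)) = (L.factorial / r' ^ L) ^ S.card := by
      have : ∀ j, ((if j ∈ S then L else 0 : ℕ).factorial : ℝ) /
          r' ^ (if j ∈ S then L else 0 : ℕ) = if j ∈ S then L.factorial / r' ^ L else 1 := by
        intro j; split_ifs <;> simp
      simp only [this]
      rw [Finset.prod_ite_mem, Finset.univ_inter, Finset.prod_const]
    have h1 := hMb z hz (fun j => if j ∈ S then L else 0)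
    rw [hprod] at h1
    calc _ ≤ ((2 * a / ((L : ℝ) - 1)) ^ L) ^ S.card * (M * (L.factorial / r' ^ L) ^ S.card) := by
          gcongr
      _ = M * ((2 * a / ((L : ℝ) - 1)) ^ L * (L.factorial / r' ^ L)) ^ S.card := by
          rw [mul_pow]; ring
      _ ≤ (M + 1) * (D * q ^ L) ^ S.card := by
          gcongr
          linarith
      _ = (M + 1) * (D ^ S.card * (q ^ L) ^ S.card) := by rw [mul_pow]
      _ ≤ (M + 1) * (D ^ Fintype.card ι * q ^ L) := by
          gcongr
          · exact Finset.card_le_univ S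
          -- Nonemptiness of `S` guarantees at least one factor `q ^ L`; further ones are at most 1.
          · exact pow_le_of_le_one (by positivity) (pow_le_one₀ hq0.le hq1) hS.card_pos.ne'
      _ = _ := by ring

theorem theorem3p1 {d : ℕ} (G : (Fin d → ℝ) → (Fin d → ℝ) → ℂ)
    (MAC : Cell d → Cell d → Bool) (t s : Cell d) (a R : ℝ)
    (ht : t.radius = a) (hs : s.radius = a)
    (hR : 2 * a / Real.exp 1 < R)
    (hMAC : MAC t s = true → AnalyticOnCubeWithRadius (shiftedKernel G t s) a R)
    (hts : MAC t s = true) :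
    TendstoUniformlyOn (fun L : ℕ => tensorInterp a L (shiftedKernel G t s))
        (shiftedKernel G t s) atTop (cube (Fin d ⊕ Fin d) a) ∧
      ∀ r : ℝ, 2 * a / Real.exp 1 < r → r < R →
        ∃ C : ℝ, 0 < C ∧ ∀ L : ℕ, 2 ≤ L → ∀ z ∈ cube (Fin d ⊕ Fin d) a,
          ‖tensorInterp a L (shiftedKernel G t s) z - shiftedKernel G t s z‖ ≤
            C * (r ^ (2 * d))⁻¹ * (2 ^ (2 * d) - 1) * (Real.exp 1 / √2) ^ (2 * d) *
              (2 * a / (r * Real.exp 1)) ^ L := by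
  have ha : 0 < a := ht ▸ t.radius_pos
  have he := Real.exp_pos 1
  have han := hMAC hts
  have hcard : Fintype.card (Fin d ⊕ Fin d) = 2 * d := by simp [two_mul]
  constructor
  · obtain ⟨r, hr, hrR⟩ := exists_between hR
    have hr0 : 0 < r := lt_trans (by positivity) hr
    obtain ⟨C, hC, hb⟩ := han.exists_norm_tensorInterp_sub_le ha hr hrR
    have hq1 : 2 * a / (r * Real.exp 1) < 1 := by
      rw [div_lt_one (by positivity)]
      rwa [div_lt_iff₀ he] at hr
    have hlim : Tendsto (fun L : ℕ => (2 ^ Fintype.card (Fin d ⊕ Fin d) - 1) *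
        (C * (2 * a / (r * Real.exp 1)) ^ L)) atTop (𝓝 0) := by
      have := ((tendsto_pow_atTop_nhds_zero_of_lt_one (by positivity) hq1).const_mul C).const_mul
        (2 ^ Fintype.card (Fin d ⊕ Fin d) - 1)
      simpa only [mul_zero] using this
    rw [Metric.tendstoUniformlyOn_iff]
    intro ε hε
    filter_upwards [hlim.eventually_lt_const hε, eventually_ge_atTop 2] with L hL hL2 z hz
    rw [dist_comm, dist_eq_norm]
    exact (hb L hL2 z hz).trans_lt hL
  · intro r hr hrR
    have hr0 : 0 < r := lt_trans (by positivity) hr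
    obtain ⟨C, hC, hb⟩ := han.exists_norm_tensorInterp_sub_le ha hr hrR
    -- The `L`-independent factors of the stated bound are cancelled by the choice of constant.
    refine ⟨C * r ^ (2 * d) * ((Real.exp 1 / √2) ^ (2 * d))⁻¹, by positivity, fun L hL z hz => ?_⟩
    refine (hb L hL z hz).trans (le_of_eq ?_)
    rw [hcard]
    have h1 : (Real.exp 1 / √2) ^ (2 * d) ≠ 0 := by positivity
    have h2 : r ^ (2 * d) ≠ 0 := by positivity
    generalize (Real.exp 1 / √2) ^ (2 * d) = x at *
    generalize r ^ (2 * d) = y at *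
    field_simp
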